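/- For $n\ge 0$ define the Laakso graph $L_n$ as follows. $L_0$ consists of two vertices joined by an edge of length $1$. The graph $L_n$ is obtained from $L_{n-1}$ by replacing each edge $uv$ (of length $4^{-n+1}$) by a graph with the six vertices $u,t_1,t_2,o_1,o_2,v$ and the six edges $ut_1$, $t_1o_1$, $t_1o_2$, $o_1t_2$, $o_2t_2$, $t_2v$, all of length $4^{-n}$, where $t_1,t_2,o_1,o_2$ are new vertices. The vertex set $V(L_n)$ carries the shortest path metric $d_{L_n}$, and $V(L_n)\subseteq V(L_{n+1})$ isometrically. The countable Laakso space is $L_\omega=\bigcup_{n\ge 0}V(L_n)$ with the metric $d_{L_\omega}(u,v)=d_{L_n}(u,v)$ for any $n$ with $u,v\in V(L_n)$. A map $F:M\to N$ between metric spaces is a bilipschitz embedding if there are $r>0$ and $C<\infty$ such that $r\,d_M(u,v)\le d_N(F(u),F(v))\le rC\,d_M(u,v)$ for all $u,v\in M$. A Banach space $X$ has the Radon–Nikodým property if for every finite measure space $(\Omega,\Sigma,\mu)$ and every countably additive $\nu:\Sigma\to X$ of bounded variation with $\nu\ll\mu$ there is a Bochner integrable $f:\Omega\to X$ with $\nu(E)=\int_E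 f\,d\mu$ for all $E\in\Sigma$. **Theorem.** If $L_\omega$ admits a bilipschitz embedding into a Banach space $X$, then $X$ does not have the Radon–Nikodým property. -/

import Mathlib

open MeasureTheory
open scoped MeasureTheory ENNReal

/-- The four new vertices of the graph with vertices `u, t₁, t₂, o₁, o₂, v` that replaces an
edge `uv`. -/
inductive LaaksoNode
  | t₁ | t₂ | o₁ | o₂
  deriving DecidableEq

/-- The six edges of the graph that replaces an edge `uv`: the quadrilateral `o₁, t₁, o₂, t₂`
and the two edges `ut₁` and `t₂v`. They are listed with an orientation from `u` to `v`. -/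
inductive LaaksoSlot
  | ut₁ | t₁o₁ | t₁o₂ | o₁t₂ | o₂t₂ | t₂v
  deriving DecidableEq

/-- The points of the countable Laakso space, i.e. the union of the vertex sets of all Laakso
graphs. The points `u₀`, `v₀` are the vertices of the graph of level `0`. An edge of the graph of
level `n` is encoded by a list `a` of length `n`, which records (latest choice first) which of the
six edges is taken in each of the `n` replacements; `mid a k` is the new vertex `k` that appears
when the edge `a` is replaced. -/
inductive LaaksoSpace
  | u₀ : LaaksoSpace
  | v₀ : LaaksoSpace
  | mid (a : List LaaksoSlot) (k : LaaksoNode) : LaaksoSpace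
  deriving DecidableEq

namespace LaaksoSpace

/-- The two endpoints of the edge encoded by a list. -/
def ends : List LaaksoSlot → LaaksoSpace × LaaksoSpace
  | [] => (u₀, v₀)
  | .ut₁ :: a => ((ends a).1, mid a .t₁)
  | .t₁o₁ :: a => (mid a .t₁, mid a .o₁)
  | .t₁o₂ :: a => (mid a .t₁, mid a .o₂)
  | .o₁t₂ :: a => (mid a .o₁, mid a .t₂)
  | .o₂t₂ :: a => (mid a .o₂, mid a .t₂)
  | .t₂v :: a => (mid a .t₂, (ends a).2)

/-- The least `n` such that the point is a vertex of the Laakso graph of level `n`. -/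
def level : LaaksoSpace → ℕ
  | u₀ => 0
  | v₀ => 0
  | mid a _ => a.length + 1

/-- The vertex set of the Laakso graph of level `n`. -/
def vertices (n : ℕ) : Set LaaksoSpace := {x | x.level ≤ n}

/-- The Laakso graph of level `n`; points outside `vertices n` are isolated in it. -/
def graph (n : ℕ) : SimpleGraph LaaksoSpace :=
  SimpleGraph.fromRel fun x y => ∃ a : List LaaksoSlot, a.length = n ∧ ends a = (x, y)

/-- The shortest path distance of the Laakso graph of level `n`, whose edges have length
`4⁻ⁿ`. -/
noncomputable def levelDist (n : ℕ) (x y : LaaksoSpace) : ℝ :=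
  (1 / 4 : ℝ) ^ n * ((graph n).dist x y : ℝ)

theorem mem_vertices {n : ℕ} {x : LaaksoSpace} : x ∈ vertices n ↔ x.level ≤ n := Iff.rfl

theorem level_ends (a : List LaaksoSlot) :
    (ends a).1.level ≤ a.length ∧ (ends a).2.level ≤ a.length := by
  induction a with
  | nil => simp [ends, level]
  | cons s a ih =>
    cases s
    · exact ⟨ih.1.trans (Nat.le_succ _), le_rfl⟩
    · exact ⟨le_rfl, le_rfl⟩
    · exact ⟨le_rfl, le_rfl⟩
    · exact ⟨le_rfl, le_rfl⟩
    · exact ⟨le_rfl, le_rfl⟩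
    · exact ⟨le_rfl, ih.2.trans (Nat.le_succ _)⟩

theorem ends_ne (a : List LaaksoSlot) : (ends a).1 ≠ (ends a).2 := by
  cases a with
  | nil => simp [ends]
  | cons s a =>
    have h := level_ends a
    cases s
    · intro h'
      have h1 : (ends a).1 = mid a .t₁ := h'
      rw [h1] at h
      exact absurd h.1 (Nat.not_succ_le_self _)
    · simp [ends]
    · simp [ends]
    · simp [ends]
    · simp [ends]
    · intro h'
      have h1 : mid a .t₂ = (ends a).2 := h'
      rw [← h1] at h
      exact absurd h.2 (Nat.not_succ_le_self _)

theorem adj_ends (a : List LaaksoSlot) : (graph a.length).Adj (ends a).1 (ends a).2 := by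
  rw [graph, SimpleGraph.fromRel_adj]
  exact ⟨ends_ne a, Or.inl ⟨a, rfl, rfl⟩⟩

theorem exists_of_adj {n : ℕ} {x y : LaaksoSpace} (h : (graph n).Adj x y) :
    ∃ a : List LaaksoSlot, a.length = n ∧ (ends a = (x, y) ∨ ends a = (y, x)) := by
  rw [graph, SimpleGraph.fromRel_adj] at h
  rcases h.2 with ⟨a, ha, h⟩ | ⟨a, ha, h⟩
  · exact ⟨a, ha, Or.inl h⟩
  · exact ⟨a, ha, Or.inr h⟩

/-- After the replacement the endpoints of an edge are joined by a path of length four. -/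
theorem exists_walk_ends (a : List LaaksoSlot) :
    ∃ p : (graph (a.length + 1)).Walk (ends a).1 (ends a).2, p.length = 4 :=
  ⟨.cons (adj_ends (.ut₁ :: a)) (.cons (adj_ends (.t₁o₁ :: a))
    (.cons (adj_ends (.o₁t₂ :: a)) (.cons (adj_ends (.t₂v :: a)) .nil))), rfl⟩

theorem exists_walk_succ {n : ℕ} {x y : LaaksoSpace} (p : (graph n).Walk x y) :
    ∃ q : (graph (n + 1)).Walk x y, q.length = 4 * p.length := by
  induction p with
  | nil => exact ⟨.nil, rfl⟩
  | cons h p ih =>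
    obtain ⟨q, hq⟩ := ih
    obtain ⟨a, rfl, ha⟩ := exists_of_adj h
    obtain ⟨w, hw⟩ := exists_walk_ends a
    rcases ha with ha | ha
    · obtain ⟨rfl, rfl⟩ := Prod.ext_iff.1 ha
      exact ⟨w.append q, by simp [hw, hq]; ring⟩
    · obtain ⟨rfl, rfl⟩ := Prod.ext_iff.1 ha
      exact ⟨w.reverse.append q, by simp [hw, hq]; ring⟩

theorem reachable_succ {n : ℕ} {x y : LaaksoSpace} (h : (graph n).Reachable x y) :
    (graph (n + 1)).Reachable x y := by
  obtain ⟨p⟩ := h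
  obtain ⟨q, -⟩ := exists_walk_succ p
  exact ⟨q⟩

theorem reachable_mid (a : List LaaksoSlot) (k : LaaksoNode) :
    (graph (a.length + 1)).Reachable (ends a).1 (mid a k) := by
  have h1 : (graph (a.length + 1)).Adj (ends a).1 (mid a .t₁) := adj_ends (.ut₁ :: a)
  have h2 : (graph (a.length + 1)).Adj (mid a .t₁) (mid a .o₁) := adj_ends (.t₁o₁ :: a)
  have h3 : (graph (a.length + 1)).Adj (mid a .t₁) (mid a .o₂) := adj_ends (.t₁o₂ :: a)
  have h4 : (graph (a.length + 1)).Adj (mid a .o₁) (mid a .t₂) := adj_ends (.o₁t₂ :: a)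
  cases k
  · exact h1.reachable
  · exact h1.reachable.trans (h2.reachable.trans h4.reachable)
  · exact h1.reachable.trans h2.reachable
  · exact h1.reachable.trans h3.reachable

theorem reachable_ends (a : List LaaksoSlot) : (graph a.length).Reachable u₀ (ends a).1 := by
  induction a with
  | nil => exact SimpleGraph.Reachable.refl _
  | cons s a ih =>
    have ih' := reachable_succ ih
    cases s
    · exact ih'
    all_goals exact ih'.trans (reachable_mid a _)

theorem reachable_base {n : ℕ} {x : LaaksoSpace} (hx : x ∈ vertices n) :
    (graph n).Reachable u₀ x := by
  have key : (graph x.level).Reachable u₀ x := by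
    cases x with
    | u₀ => exact SimpleGraph.Reachable.refl _
    | v₀ => exact (adj_ends []).reachable
    | mid a k => exact (reachable_succ (reachable_ends a)).trans (reachable_mid a k)
  have hx' : x.level ≤ n := hx
  induction n, hx' using Nat.le_induction with
  | base => exact key
  | succ m hm ih => exact reachable_succ (ih hm)

/-- The Laakso graph of level `n` is connected. -/
theorem reachable {n : ℕ} {x y : LaaksoSpace} (hx : x ∈ vertices n) (hy : y ∈ vertices n) :
    (graph n).Reachable x y :=
  (reachable_base hx).symm.trans (reachable_base hy)

/-- An auxiliary potential on the graph of level `n + 1`, which extends four times the distance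
to `x` in the graph of level `n`. -/
noncomputable def potential (n : ℕ) (x : LaaksoSpace) : LaaksoSpace → ℕ
  | mid a k =>
    if a.length < n then 4 * (graph n).dist x (mid a k)
    else match k with
      | .t₁ => min (4 * (graph n).dist x (ends a).1 + 1) (4 * (graph n).dist x (ends a).2 + 3)
      | .o₁ => min (4 * (graph n).dist x (ends a).1 + 2) (4 * (graph n).dist x (ends a).2 + 2)
      | .o₂ => min (4 * (graph n).dist x (ends a).1 + 2) (4 * (graph n).dist x (ends a).2 + 2)
      | .t₂ => min (4 * (graph n).dist x (ends a).1 + 3) (4 * (graph n).dist x (ends a).2 + 1)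
  | w => 4 * (graph n).dist x w

theorem potential_of_mem {n : ℕ} (x : LaaksoSpace) {w : LaaksoSpace} (hw : w ∈ vertices n) :
    potential n x w = 4 * (graph n).dist x w := by
  cases w with
  | u₀ => rfl
  | v₀ => rfl
  | mid a k =>
    have h : a.length < n := hw
    simp [potential, h]

theorem potential_mid (a : List LaaksoSlot) (x : LaaksoSpace) (k : LaaksoNode) :
    potential a.length x (mid a k) = match k with
      | .t₁ => min (4 * (graph a.length).dist x (ends a).1 + 1)
          (4 * (graph a.length).dist x (ends a).2 + 3)
      | .o₁ => min (4 * (graph a.length).dist x (ends a).1 + 2)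
          (4 * (graph a.length).dist x (ends a).2 + 2)
      | .o₂ => min (4 * (graph a.length).dist x (ends a).1 + 2)
          (4 * (graph a.length).dist x (ends a).2 + 2)
      | .t₂ => min (4 * (graph a.length).dist x (ends a).1 + 3)
          (4 * (graph a.length).dist x (ends a).2 + 1) := by
  simp [potential]

theorem potential_adj {n : ℕ} {x y z : LaaksoSpace} (hx : x ∈ vertices n)
    (h : (graph (n + 1)).Adj y z) : potential n x z ≤ potential n x y + 1 := by
  obtain ⟨b, hb, h⟩ := exists_of_adj h
  cases b with
  | nil => simp at hb
  | cons s a =>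
    have ha : a.length = n := by simpa using hb
    subst ha
    have h1 := potential_of_mem x (level_ends a).1
    have h2 := potential_of_mem x (level_ends a).2
    have h3 := (reachable hx (level_ends a).1).dist_triangle_left (ends a).2
    have h4 := (reachable hx (level_ends a).2).dist_triangle_left (ends a).1
    have h5 : (graph a.length).dist (ends a).1 (ends a).2 = 1 :=
      SimpleGraph.dist_eq_one_iff_adj.2 (adj_ends a)
    rw [SimpleGraph.dist_comm (u := (ends a).2), h5] at h4
    rw [h5] at h3
    have m1 := potential_mid a x .t₁
    have m2 := potential_mid a x .t₂
    have m3 := potential_mid a x .o₁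
    have m4 := potential_mid a x .o₂
    simp only at m1 m2 m3 m4
    cases s <;> simp only [ends, Prod.mk.injEq] at h <;>
      rcases h with ⟨rfl, rfl⟩ | ⟨rfl, rfl⟩ <;> omega

theorem potential_le_walk {n : ℕ} {x y z : LaaksoSpace} (hx : x ∈ vertices n)
    (p : (graph (n + 1)).Walk y z) : potential n x z ≤ potential n x y + p.length := by
  induction p with
  | nil => simp
  | cons h p ih =>
    have := potential_adj hx h
    simp only [SimpleGraph.Walk.length_cons]
    omega

theorem dist_succ {n : ℕ} {x y : LaaksoSpace} (hx : x ∈ vertices n) (hy : y ∈ vertices n) :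
    (graph (n + 1)).dist x y = 4 * (graph n).dist x y := by
  have hr := reachable hx hy
  apply le_antisymm
  · obtain ⟨p, hp⟩ := hr.exists_walk_length_eq_dist
    obtain ⟨q, hq⟩ := exists_walk_succ p
    have := SimpleGraph.dist_le q
    omega
  · obtain ⟨p, hp⟩ := (reachable_succ hr).exists_walk_length_eq_dist
    have := potential_le_walk hx p
    rw [potential_of_mem x hy, potential_of_mem x hx, SimpleGraph.dist_self] at this
    omega

theorem vertices_mono {m n : ℕ} (h : m ≤ n) : vertices m ⊆ vertices n :=
  fun _ hx => le_trans hx h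

/-- The inclusions of vertex sets are isometric embeddings. -/
theorem levelDist_eq {m n : ℕ} (hmn : m ≤ n) {x y : LaaksoSpace} (hx : x ∈ vertices m)
    (hy : y ∈ vertices m) : levelDist n x y = levelDist m x y := by
  induction n, hmn using Nat.le_induction with
  | base => rfl
  | succ n hn ih =>
    rw [← ih, levelDist, levelDist, dist_succ (vertices_mono hn hx) (vertices_mono hn hy)]
    push_cast
    ring

noncomputable instance : Dist LaaksoSpace :=
  ⟨fun x y => levelDist (max x.level y.level) x y⟩

/-- The distance of two points of the Laakso space is their distance in any Laakso graph that
contains both. -/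
theorem dist_eq_levelDist {n : ℕ} {x y : LaaksoSpace} (hx : x ∈ vertices n)
    (hy : y ∈ vertices n) : dist x y = levelDist n x y :=
  (levelDist_eq (max_le hx hy) (mem_vertices.2 (le_max_left _ _))
    (mem_vertices.2 (le_max_right _ _))).symm

noncomputable instance : MetricSpace LaaksoSpace where
  dist_self x := by simp [dist, levelDist]
  dist_comm x y := by
    simp only [dist, levelDist]
    rw [max_comm, SimpleGraph.dist_comm]
  dist_triangle x y z := by
    have hx : x ∈ vertices (x.level + y.level + z.level) := mem_vertices.2 (by omega)
    have hy : y ∈ vertices (x.level + y.level + z.level) := mem_vertices.2 (by omega)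
    have hz : z ∈ vertices (x.level + y.level + z.level) := mem_vertices.2 (by omega)
    rw [dist_eq_levelDist hx hz, dist_eq_levelDist hx hy, dist_eq_levelDist hy hz, levelDist,
      levelDist, levelDist, ← mul_add]
    have := (reachable hx hy).dist_triangle_left z
    gcongr
    exact_mod_cast this
  eq_of_dist_eq_zero {x y} h := by
    have hr := reachable (n := max x.level y.level) (x := x) (y := y)
      (mem_vertices.2 (le_max_left _ _)) (mem_vertices.2 (le_max_right _ _))
    simp only [dist, levelDist, mul_eq_zero] at h
    rcases h with h | h
    · exact absurd h (by positivity)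
    · exact hr.dist_eq_zero_iff.1 (by exact_mod_cast h)

end LaaksoSpace

/-- A map `F` between metric spaces is a bilipschitz embedding if, for some `r > 0` and `C`,
`r d(u, v) ≤ d(F u, F v) ≤ r C d(u, v)` for all `u`, `v`. -/
def IsBilipschitzEmbedding {M N : Type*} [MetricSpace M] [MetricSpace N] (F : M → N) : Prop :=
  ∃ C r : ℝ, 0 < r ∧ ∀ u v : M, r * dist u v ≤ dist (F u) (F v) ∧
    dist (F u) (F v) ≤ r * C * dist u v

/-- The Radon–Nikodým property: for every finite measure space `(Ω, μ)`, every countably additive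
`X`-valued measure of bounded variation that is absolutely continuous with respect to `μ` has a
Bochner integrable density with respect to `μ`. The sample spaces `Ω` range over the lowest
universe, so that failure of the property here is failure on an ordinary small measure space. -/
def HasRadonNikodymProperty (X : Type*) [NormedAddCommGroup X] [NormedSpace ℝ X] : Prop :=
  ∀ (Ω : Type) [MeasurableSpace Ω] (μ : Measure Ω) [IsFiniteMeasure μ] (ν : VectorMeasure Ω X),
    ν.variation Set.univ < ∞ → ν ≪ᵥ μ.toENNRealVectorMeasure →
      ∃ f : Ω → X, Integrable f μ ∧ ∀ E : Set Ω, MeasurableSet E → ν E = ∫ ω in E, f ω ∂μ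

/-!
Let `f` be a bilipschitz map from the countable Laakso space into `X`. The proof produces from `f` a
Lipschitz curve `ℝ → X` that is nowhere differentiable on `(0, 1)`. This is impossible if `X` has
the Radon–Nikodým property.

*The curve.* When an edge `uv` is replaced by a quadrilateral with the two intermediate edges, the
images of the opposite vertices `o₁`, `o₂` are at a distance comparable to the length of `uv`, so
one of them is that far from the midpoint of `f u` and `f v` (`LaaksoSpace.exists_side_far`). A
geodesic from `u₀` to `v₀` may choose, in every quadrilateral that it meets, the side of this
vertex; the choices at different edges are independent. Parametrised by arc length it maps the
`4`-adic points of `[0, 1]` to vertices, and the increments of `f` along its edges are additive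
under subdivision. They therefore come from a Lipschitz curve
(`exists_lipschitzWith_of_increments`), whose value at the midpoint of every `4`-adic interval
is far, relative to the length of the interval, from the midpoint of its values at the ends. At a
point of differentiability this fails for the small `4`-adic intervals around the point
(`DifferentiableAt.eventually_norm_midpoint_sub_le`).

*Differentiability.* The increments of a Lipschitz curve over intervals extend to a countably
additive vector measure dominated by a multiple of Lebesgue measure. If `X` has the Radon–Nikodým
property, this measure has a density, and by the Lebesgue differentiation theorem the density is
almost everywhere the derivative of the curve
(`LipschitzWith.ae_differentiableAt_of_hasRadonNikodymProperty`).
-/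

/-! ### Lipschitz curves in spaces with the Radon–Nikodým property -/

section RadonNikodym

open Set Filter
open scoped Topology NNReal

variable {X : Type*} [NormedAddCommGroup X]

/-- The increments of a Lipschitz curve, restricted to a bounded interval, extend to a countably
additive vector measure dominated by a multiple of Lebesgue measure. -/
theorem LipschitzWith.exists_vectorMeasure_Ioc [CompleteSpace X] {K : ℝ≥0} {h : ℝ → X}
    (hK : LipschitzWith K h) {a b : ℝ} (hab : a ≤ b) :
    ∃ ν : VectorMeasure ℝ X, (∀ x ∈ Icc a b, ν (Ioc a x) = h x - h a) ∧
      ∀ s, ‖ν s‖ₑ ≤ (K • volume.restrict (Ioc a b)) s := by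
  -- Clamping the parameter to `[a, b]` kills the increments outside the interval.
  let g : ℝ → X := fun x => h (max a (min x b))
  have hm : ∀ s ∈ {s : Set ℝ | ∃ u v, u ≤ v ∧ s = Ioc u v},
      ‖AddContent.onIoc g s‖ₑ ≤ (K • volume.restrict (Ioc a b)) s := by
    rintro s ⟨u, v, huv, rfl⟩
    rw [AddContent.onIoc_apply huv, ← edist_eq_enorm_sub]
    refine (hK _ _).trans ?_
    rw [Measure.smul_apply, Measure.restrict_apply measurableSet_Ioc, Ioc_inter_Ioc,
      Real.volume_Ioc, edist_dist, Real.dist_eq, ENNReal.smul_def, smul_eq_mul]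
    gcongr 1
    rw [abs_of_nonneg (sub_nonneg.2 (by gcongr))]
    rcases le_total (min v b) (max u a) with h1 | h1
    · rw [ENNReal.ofReal_of_nonpos (by grind)]
      exact bot_le
    · exact ENNReal.ofReal_le_ofReal (by grind)
  have hgen : (inferInstance : MeasurableSpace ℝ)
      = MeasurableSpace.generateFrom {s : Set ℝ | ∃ u v, u ≤ v ∧ s = Ioc u v} := by
    rw [BorelSpace.measurable_eq (α := ℝ)]
    convert! borel_eq_generateFrom_Ioc_le ℝ using 2
    grind only
  obtain ⟨ν, hν, hle⟩ :=
    VectorMeasure.exists_extension_of_isSetSemiring_of_le_measure_of_generateFrom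
      IsSetSemiring.Ioc hm hgen
  refine ⟨ν, fun x hx => ?_, hle⟩
  rw [hν _ ⟨a, x, hx.1, rfl⟩, AddContent.onIoc_apply hx.1]
  simp only [g]
  rw [min_eq_left hx.2, max_eq_right hx.1, min_eq_left hab, max_self]

variable [NormedSpace ℝ X]

/-- The Radon–Nikodým property implies the Gelfand–Fréchet property: Lipschitz curves are almost
everywhere differentiable. The density of the measure of increments is the derivative, by Lebesgue
differentiation. -/
theorem LipschitzWith.ae_differentiableAt_of_hasRadonNikodymProperty [CompleteSpace X]
    (hX : HasRadonNikodymProperty X) {K : ℝ≥0} {h : ℝ → X} (hK : LipschitzWith K h)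
    {a b : ℝ} (hab : a ≤ b) : ∀ᵐ x, x ∈ Ioo a b → DifferentiableAt ℝ h x := by
  obtain ⟨ν, hν, hle⟩ := hK.exists_vectorMeasure_Ioc hab
  have hvar : ν.variation univ < ∞ :=
    (VectorMeasure.variation_le_of_forall_enorm_le (fun s _ => hle s) univ).trans_lt
      (measure_lt_top _ _)
  have hac : ν ≪ᵥ (volume.restrict (Ioc a b)).toENNRealVectorMeasure := by
    refine VectorMeasure.AbsolutelyContinuous.mk fun s hs h0 => ?_
    rw [Measure.toENNRealVectorMeasure_apply_measurable hs] at h0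
    simpa [h0] using hle s
  obtain ⟨f, hf, hfν⟩ := hX ℝ (volume.restrict (Ioc a b)) ν hvar hac
  have hint : IntervalIntegrable f volume a b :=
    (intervalIntegrable_iff_integrableOn_Ioc_of_le hab).2 hf
  have heq : ∀ x ∈ Icc a b, h x = h a + ∫ t in a..x, f t := by
    intro x hx
    have h1 := hfν (Ioc a x) measurableSet_Ioc
    rw [hν x hx, Measure.restrict_restrict measurableSet_Ioc,
      inter_eq_left.2 (Ioc_subset_Ioc_right hx.2), ← intervalIntegral.integral_of_le hx.1] at h1
    rw [← h1]
    abel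
  filter_upwards [hint.ae_hasDerivAt_integral] with x hx hxm
  rw [uIcc_of_le hab] at hx
  have hd := (hx (Ioo_subset_Icc_self hxm) a (left_mem_Icc.2 hab)).const_add (h a)
  refine (hd.congr_of_eventuallyEq ?_).differentiableAt
  filter_upwards [Ioo_mem_nhds hxm.1 hxm.2] with y hy using heq y (Ioo_subset_Icc_self hy)

/-- At a point of differentiability, a curve deviates from its chords by little compared with their
length, on all small intervals around the point. -/
theorem DifferentiableAt.eventually_norm_midpoint_sub_le {h : ℝ → X} {x : ℝ}
    (hx : DifferentiableAt ℝ h x) {ε : ℝ} (hε : 0 < ε) :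
    ∃ δ > 0, ∀ s ℓ : ℝ, ℓ < δ → s ≤ x → x ≤ s + ℓ →
      ‖(2 : ℝ) • h (s + ℓ / 2) - (h s + h (s + ℓ))‖ ≤ ε * ℓ := by
  have hd := (hasDerivAt_iff_isLittleO.1 hx.hasDerivAt).def (c := ε / 4) (by positivity)
  obtain ⟨δ, hδ, hb⟩ := Metric.eventually_nhds_iff.1 hd
  refine ⟨δ, hδ, fun s ℓ hℓ h1 h2 => ?_⟩
  have key : ∀ y ∈ Icc s (s + ℓ), ‖h y - h x - (y - x) • deriv h x‖ ≤ ε / 4 * ℓ := by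
    intro y hy
    have hyx : |y - x| ≤ ℓ := abs_le.2 ⟨by linarith [hy.1], by linarith [hy.2]⟩
    refine (hb (by rw [Real.dist_eq]; exact hyx.trans_lt hℓ)).trans ?_
    rw [Real.norm_eq_abs]
    gcongr
  have k1 := key s ⟨le_rfl, by linarith⟩
  have k2 := key (s + ℓ / 2) ⟨by linarith, by linarith⟩
  have k3 := key (s + ℓ) ⟨by linarith, le_rfl⟩
  have e : (2 : ℝ) • h (s + ℓ / 2) - (h s + h (s + ℓ))
      = (2 : ℝ) • (h (s + ℓ / 2) - h x - (s + ℓ / 2 - x) • deriv h x)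
        - (h s - h x - (s - x) • deriv h x) - (h (s + ℓ) - h x - (s + ℓ - x) • deriv h x) := by
    module
  rw [e]
  refine (norm_sub_le _ _).trans ((add_le_add (norm_sub_le _ _) le_rfl).trans ?_)
  rw [norm_smul, Real.norm_ofNat]
  linarith

/-- A space that contains a Lipschitz curve whose midpoints stay away from the chords, at the scale
of all `4`-adic intervals, lacks the Radon–Nikodým property. -/
theorem not_hasRadonNikodymProperty_of_curve [CompleteSpace X] {K : ℝ≥0} {h : ℝ → X}
    (hK : LipschitzWith K h) {c : ℝ} (hc : 0 < c)
    (hmid : ∀ n k : ℕ, c * (1 / 4) ^ n ≤ ‖(2 : ℝ) • h (k * (1 / 4) ^ n + (1 / 4) ^ n / 2)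
      - (h (k * (1 / 4) ^ n) + h (k * (1 / 4) ^ n + (1 / 4) ^ n))‖) :
    ¬ HasRadonNikodymProperty X := by
  intro hX
  have hae := hK.ae_differentiableAt_of_hasRadonNikodymProperty hX (zero_le_one (α := ℝ))
  obtain ⟨x, hx, hdiff⟩ : ∃ x ∈ Ioo (0 : ℝ) 1, DifferentiableAt ℝ h x := by
    by_contra! hcon
    have h0 : volume (Ioo (0 : ℝ) 1) = 0 :=
      measure_mono_null (fun x hx => by simpa [hx.1, hx.2] using hcon x hx) (ae_iff.1 hae)
    simp at h0
  obtain ⟨δ, hδ, hb⟩ := hdiff.eventually_norm_midpoint_sub_le (half_pos hc)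
  obtain ⟨n, hn⟩ := exists_pow_lt_of_lt_one hδ (by norm_num : (1 / 4 : ℝ) < 1)
  have hp : (0 : ℝ) < (1 / 4) ^ n := by positivity
  have hk1 := Nat.floor_le (div_nonneg hx.1.le hp.le)
  have hk2 := (Nat.lt_floor_add_one (x / (1 / 4) ^ n)).le
  rw [le_div_iff₀ hp] at hk1
  rw [div_le_iff₀ hp, add_one_mul] at hk2
  have := (hmid n ⌊x / (1 / 4) ^ n⌋₊).trans (hb _ _ hn hk1 hk2)
  nlinarith

end RadonNikodym

/-! ### Lipschitz curves from increments over `4`-adic intervals -/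

section Refinement

variable {X : Type*} [NormedAddCommGroup X] [CompleteSpace X]

open Filter
open scoped Topology NNReal

/-- A system of increments `D n k` over the `4`-adic intervals `[k 4⁻ⁿ, (k + 1) 4⁻ⁿ]` that is
additive under subdivision and bounded by a multiple of the length comes from a Lipschitz curve. -/
theorem exists_lipschitzWith_of_increments {D : ℕ → ℕ → X} {K : ℝ≥0}
    (hadd : ∀ n k, D n k = ∑ j ∈ Finset.range 4, D (n + 1) (4 * k + j))
    (hD : ∀ n k, ‖D n k‖ ≤ K * (1 / 4) ^ n) :
    ∃ h : ℝ → X, LipschitzWith K h ∧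
      ∀ n k : ℕ, h (k * (1 / 4) ^ n) = ∑ i ∈ Finset.range k, D n i := by
  let S : ℕ → ℕ → X := fun n k => ∑ i ∈ Finset.range k, D n i
  -- Partial sums of increments do not depend on the level at which they are formed.
  have hS : ∀ n k, S (n + 1) (4 * k) = S n k := by
    intro n k
    induction k with
    | zero => simp [S]
    | succ k ih =>
      have : S (n + 1) (4 * (k + 1)) =
          S (n + 1) (4 * k) + ∑ j ∈ Finset.range 4, D (n + 1) (4 * k + j) :=
        Finset.sum_range_add _ (4 * k) 4
      rw [this, ih, ← hadd]
      exact (Finset.sum_range_succ _ _).symm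
  have hS' : ∀ n d k, S (n + d) (4 ^ d * k) = S n k := by
    intro n d k
    induction d with
    | zero => simp
    | succ d ih => rw [pow_succ', mul_assoc, ← add_assoc, hS, ih]
  have hle : ∀ n i d, ‖S n (i + d) - S n i‖ ≤ K * (1 / 4) ^ n * d := by
    intro n i d
    have : S n (i + d) - S n i = ∑ j ∈ Finset.range d, D n (i + j) := by
      simp [S, Finset.sum_range_add]
    rw [this]
    refine (norm_sum_le_of_le _ fun j _ => hD n (i + j)).trans_eq ?_
    rw [Finset.sum_const, Finset.card_range, nsmul_eq_mul, mul_comm]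
  have hdist : ∀ n i j, dist (S n i) (S n j) ≤ K * (1 / 4) ^ n * |(i : ℝ) - j| := by
    intro n i j
    wlog hij : j ≤ i generalizing i j
    · rw [dist_comm, abs_sub_comm]
      exact this j i (le_of_not_ge hij)
    obtain ⟨d, rfl⟩ := Nat.exists_eq_add_of_le hij
    rw [dist_eq_norm]
    simpa using hle n j d
  -- The curve is the limit of the step functions that take the value `S n k` on the `k`-th interval.
  let u : ℝ → ℕ → X := fun x n => S n ⌊x * 4 ^ n⌋₊
  have hu : ∀ x n, dist (u x n) (u x (n + 1)) ≤ K * (1 / 4) ^ n := by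
    intro x n
    have hfl : ⌊x * 4 ^ n⌋₊ = ⌊x * 4 ^ (n + 1)⌋₊ / 4 := by
      rw [← Nat.floor_div_ofNat, pow_succ, ← mul_assoc, mul_div_cancel_right₀ _ (by norm_num)]
    have hmod := Nat.div_add_mod ⌊x * 4 ^ (n + 1)⌋₊ 4
    have hlt := Nat.mod_lt ⌊x * 4 ^ (n + 1)⌋₊ (by norm_num : 4 > 0)
    simp only [u, hfl]
    rw [← hS, dist_comm, dist_eq_norm]
    nth_rewrite 1 [← hmod]
    refine (hle _ _ _).trans ?_
    have : ((⌊x * 4 ^ (n + 1)⌋₊ % 4 : ℕ) : ℝ) ≤ 4 := by exact_mod_cast hlt.le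
    calc (K : ℝ) * (1 / 4) ^ (n + 1) * ((⌊x * 4 ^ (n + 1)⌋₊ % 4 : ℕ) : ℝ)
        ≤ K * (1 / 4) ^ (n + 1) * 4 := by gcongr
      _ = K * (1 / 4) ^ n := by ring
  have hlim : ∀ x, ∃ y, Tendsto (u x) atTop (𝓝 y) := fun x =>
    cauchySeq_tendsto_of_complete (cauchySeq_of_le_geometric _ _ (by norm_num) (hu x))
  choose h hh using hlim
  refine ⟨h, LipschitzWith.of_dist_le_mul fun x y => ?_, fun n k => ?_⟩
  · have hpow : Tendsto (fun n : ℕ => K * dist x y + K * (1 / 4 : ℝ) ^ n) atTop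
        (𝓝 (K * dist x y + K * 0)) :=
      ((tendsto_pow_atTop_nhds_zero_of_lt_one (by norm_num) (by norm_num)).const_mul _).const_add _
    rw [mul_zero, add_zero] at hpow
    refine le_of_tendsto_of_tendsto' ((hh x).dist (hh y)) hpow fun n => ?_
    refine (hdist _ _ _).trans ?_
    have hfl : |(⌊x * 4 ^ n⌋₊ : ℝ) - ⌊y * 4 ^ n⌋₊| ≤ |x - y| * 4 ^ n + 1 := by
      wlog hxy : y ≤ x generalizing x y
      · rw [abs_sub_comm, abs_sub_comm x]
        exact this y x (by simpa [dist_comm] using hpow) (le_of_not_ge hxy)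
      have hxy' : y * 4 ^ n ≤ x * 4 ^ n := by gcongr
      have hfl' : (⌊y * 4 ^ n⌋₊ : ℝ) ≤ ⌊x * 4 ^ n⌋₊ := by exact_mod_cast Nat.floor_mono hxy'
      rw [abs_of_nonneg (sub_nonneg.2 hfl'), abs_of_nonneg (sub_nonneg.2 hxy), sub_mul]
      have h2 := Nat.lt_floor_add_one (y * 4 ^ n)
      rcases le_total 0 (x * 4 ^ n) with h0 | h0
      · linarith [Nat.floor_le h0]
      · rw [Nat.floor_of_nonpos h0]
        have : (0 : ℝ) ≤ ⌊y * 4 ^ n⌋₊ := by positivity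
        push_cast
        linarith
    calc (K : ℝ) * (1 / 4) ^ n * |(⌊x * 4 ^ n⌋₊ : ℝ) - ⌊y * 4 ^ n⌋₊|
        ≤ K * (1 / 4) ^ n * (|x - y| * 4 ^ n + 1) := by gcongr
      _ = K * (|x - y| * ((1 / 4) ^ n * 4 ^ n)) + K * (1 / 4) ^ n := by ring
      _ = K * dist x y + K * (1 / 4) ^ n := by
        rw [← mul_pow, Real.dist_eq]; norm_num
  · refine tendsto_nhds_unique (hh _) (tendsto_const_nhds.congr' ?_)
    filter_upwards [eventually_ge_atTop n] with m hm
    obtain ⟨d, rfl⟩ := Nat.exists_eq_add_of_le hm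
    have : (k : ℝ) * (1 / 4) ^ n * 4 ^ (n + d) = ((4 ^ d * k : ℕ) : ℝ) := by
      push_cast
      rw [pow_add, mul_assoc, ← mul_assoc ((1 / 4 : ℝ) ^ n), ← mul_pow]
      norm_num
      ring
    simp only [u]
    rw [this, Nat.floor_natCast, hS']

end Refinement

/-! ### A geodesic of the Laakso space adapted to a map -/

namespace LaaksoSpace

/-- The edges that replace an edge, in the order in which a shortest path through the vertex `o₁`
(for `true`) or `o₂` (for `false`) runs through them. -/
def pathSlot (b : Bool) : ℕ → LaaksoSlot
  | 0 => .ut₁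
  | 1 => if b then .t₁o₁ else .t₁o₂
  | 2 => if b then .o₁t₂ else .o₂t₂
  | _ => .t₂v

/-- The `k`-th edge, for `k < 4 ^ n`, of the path of level `n` from `u₀` to `v₀` that passes each
quadrilateral on the side prescribed by `β`. For larger `k` the numbering repeats periodically. -/
def pathEdge (β : List LaaksoSlot → Bool) : ℕ → ℕ → List LaaksoSlot
  | 0, _ => []
  | n + 1, k => pathSlot (β (pathEdge β n (k / 4))) (k % 4) :: pathEdge β n (k / 4)

theorem length_pathEdge (β : List LaaksoSlot → Bool) (n k : ℕ) : (pathEdge β n k).length = n := by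
  induction n generalizing k with
  | zero => rfl
  | succ n ih => simp [pathEdge, ih]

theorem pathEdge_succ_mul_add (β : List LaaksoSlot → Bool) (n k : ℕ) {j : ℕ} (hj : j < 4) :
    pathEdge β (n + 1) (4 * k + j) =
      pathSlot (β (pathEdge β n k)) j :: pathEdge β n k := by
  rw [pathEdge, show (4 * k + j) / 4 = k by omega, show (4 * k + j) % 4 = j by omega]

theorem dist_ends (a : List LaaksoSlot) :
    dist (ends a).1 (ends a).2 = (1 / 4) ^ a.length := by
  rw [dist_eq_levelDist (level_ends a).1 (level_ends a).2, levelDist,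
    SimpleGraph.dist_eq_one_iff_adj.2 (adj_ends a), Nat.cast_one, mul_one]

theorem le_dist_of_ne {n : ℕ} {x y : LaaksoSpace} (hx : x ∈ vertices n) (hy : y ∈ vertices n)
    (hne : x ≠ y) : (1 / 4) ^ n ≤ dist x y := by
  rw [dist_eq_levelDist hx hy, levelDist]
  have : 1 ≤ (graph n).dist x y := (reachable hx hy).pos_dist_of_ne hne
  exact le_mul_of_one_le_right (by positivity) (by exact_mod_cast this)

variable {X : Type*} [NormedAddCommGroup X]

/-- The increment of `f` along the `k`-th edge of the path selected by `β`. -/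
def pathIncrement (f : LaaksoSpace → X) (β : List LaaksoSlot → Bool) (n k : ℕ) : X :=
  f (ends (pathEdge β n k)).2 - f (ends (pathEdge β n k)).1

/-- The vertex in the middle of a side of the quadrilateral: `o₁` for `true`, `o₂` for `false`. -/
def side (b : Bool) : LaaksoNode := if b then .o₁ else .o₂

theorem pathIncrement_eq_sum (f : LaaksoSpace → X) (β : List LaaksoSlot → Bool) (n k : ℕ) :
    pathIncrement f β n k = ∑ j ∈ Finset.range 4, pathIncrement f β (n + 1) (4 * k + j) := by
  simp only [Finset.sum_range_succ, Finset.sum_range_zero, pathIncrement]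
  rw [pathEdge_succ_mul_add β n k (by norm_num : 0 < 4),
    pathEdge_succ_mul_add β n k (by norm_num : 1 < 4),
    pathEdge_succ_mul_add β n k (by norm_num : 2 < 4),
    pathEdge_succ_mul_add β n k (by norm_num : 3 < 4)]
  cases β (pathEdge β n k) <;> simp [pathSlot, ends]

/-- Half-way along the replaced edge the path is at the chosen vertex `o₁` or `o₂`. -/
theorem pathIncrement_add_pathIncrement (f : LaaksoSpace → X) (β : List LaaksoSlot → Bool)
    (n k : ℕ) :
    pathIncrement f β (n + 1) (4 * k) + pathIncrement f β (n + 1) (4 * k + 1) =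
      f (mid (pathEdge β n k) (side (β (pathEdge β n k)))) - f (ends (pathEdge β n k)).1 := by
  simp only [pathIncrement]
  rw [← Nat.add_zero (4 * k), pathEdge_succ_mul_add β n k (by norm_num : 0 < 4), Nat.add_zero,
    pathEdge_succ_mul_add β n k (by norm_num : 1 < 4)]
  cases β (pathEdge β n k) <;> simp [pathSlot, ends, side]

variable [NormedSpace ℝ X]

/-- Since the images of `o₁` and `o₂` are far apart, one of them is far from the midpoint of the
images of the two endpoints. The bound only uses that `o₁` and `o₂` are distinct vertices of the next
level, hence at distance at least `4⁻ⁿ⁻¹` if the edge has level `n`. -/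
theorem exists_side_far {f : LaaksoSpace → X} {r : ℝ} (hr : 0 ≤ r)
    (hf : ∀ u v, r * dist u v ≤ dist (f u) (f v)) (a : List LaaksoSlot) :
    ∃ b : Bool, r / 4 * (1 / 4) ^ a.length ≤
      ‖(2 : ℝ) • f (mid a (side b)) - (f (ends a).1 + f (ends a).2)‖ := by
  by_contra! hcon
  have h1 := hcon true
  have h2 := hcon false
  have hd : (1 / 4) ^ (a.length + 1) ≤ dist (mid a .o₁) (mid a .o₂) :=
    le_dist_of_ne (mem_vertices.2 le_rfl) (mem_vertices.2 le_rfl) (by simp)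
  have h3 := (mul_le_mul_of_nonneg_left hd hr).trans (hf _ _)
  have h4 := norm_sub_le
    ((2 : ℝ) • f (mid a .o₁) - (f (ends a).1 + f (ends a).2))
    ((2 : ℝ) • f (mid a .o₂) - (f (ends a).1 + f (ends a).2))
  rw [sub_sub_sub_cancel_right, ← smul_sub, norm_smul, Real.norm_ofNat, ← dist_eq_norm] at h4
  simp only [side, if_true, Bool.false_eq_true, if_false] at h1 h2
  rw [pow_succ] at h3
  linarith

end LaaksoSpace

theorem mainTheorem2 (X : Type*) [NormedAddCommGroup X] [NormedSpace ℝ X] [CompleteSpace X]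
    (h : ∃ f : LaaksoSpace → X, IsBilipschitzEmbedding f) : ¬ HasRadonNikodymProperty X := by
  obtain ⟨f, C, r, hr, hf⟩ := h
  choose β hβ using LaaksoSpace.exists_side_far hr.le fun u v => (hf u v).1
  obtain ⟨g, hg, hgD⟩ := exists_lipschitzWith_of_increments (K := (r * C).toNNReal)
    (LaaksoSpace.pathIncrement_eq_sum f β) (by
      intro n k
      rw [LaaksoSpace.pathIncrement, ← dist_eq_norm, dist_comm]
      refine (hf _ _).2.trans ?_
      rw [LaaksoSpace.dist_ends, LaaksoSpace.length_pathEdge]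
      gcongr
      exact Real.le_coe_toNNReal _)
  refine not_hasRadonNikodymProperty_of_curve hg (c := r / 4) (by positivity) fun n k => ?_
  have hs := hβ (LaaksoSpace.pathEdge β n k)
  rw [LaaksoSpace.length_pathEdge] at hs
  refine hs.trans_eq (congrArg norm ?_)
  -- The ends and the middle of the interval are the points numbered `4k`, `4k + 2` and `4(k + 1)` of
  -- the next level; the sum over the first half ends at the chosen vertex `o₁` or `o₂`.
  have e0 := hgD n k
  have e1 := hgD n (k + 1)
  have e2 := hgD (n + 1) (4 * k + 2)
  have e3 := hgD (n + 1) (4 * k)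
  have p1 : ((k + 1 : ℕ) : ℝ) * (1 / 4) ^ n = k * (1 / 4) ^ n + (1 / 4) ^ n := by
    push_cast; ring
  have p2 : ((4 * k + 2 : ℕ) : ℝ) * (1 / 4) ^ (n + 1) = k * (1 / 4) ^ n + (1 / 4) ^ n / 2 := by
    push_cast; ring
  have p3 : ((4 * k : ℕ) : ℝ) * (1 / 4) ^ (n + 1) = k * (1 / 4) ^ n := by
    push_cast; ring
  rw [p1, Finset.sum_range_succ, ← e0] at e1
  rw [p3] at e3
  rw [p2, Finset.sum_range_succ, Finset.sum_range_succ, ← e3, add_assoc,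
    LaaksoSpace.pathIncrement_add_pathIncrement] at e2
  rw [e1, e2, LaaksoSpace.pathIncrement]
  module
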